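/- All graphs are finite and simple. For an integer $k\ge 0$, a \emph{$k$-tree} is a graph that can be constructed by starting with a $(k+1)$-clique and in every step adding a new vertex whose neighbours in the already constructed graph form a $k$-clique (the new vertex is \emph{stacked onto} that clique). A \emph{simple $k$-tree} is a $k$-tree that has such a construction sequence in which no two added vertices are stacked onto the same $k$-clique. The \emph{simple tree-width} $\mathrm{stw}(G)$ of a graph $G$ is the minimum $k$ such that $G$ is a (not necessarily induced or spanning) subgraph of some simple $k$-tree. An \emph{interval graph} is the intersection graph of a family of intervals of the real line. An \emph{injective cover} of $G$ by interval graphs is a homomorphism $\varphi$ from a disjoint union $I_1 \,\dot\cup\, \cdots \,\dot\cup\, I_m$ of interval graphs ($m\ge 0$) to $G$ such that every edge of $G$ is the image of an edge and the restriction of $\varphi$ to each $I_i$ is injective. The \emph{local track-number} $t_\ell(G)$ is the minimum, over all injective covers $\varphi$ of $G$ by interval graphs, of $\max_{v\in V(G)} |\varphi^{-1}(v)|$. **Theorem.** For every graph $G$, $$t_\ell(G) \le \mathrm{stw}(G).$$ -/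

import Mathlib

universe u

section SimpleTreeWidth

/-- The neighbours of the `i`-th vertex that come before it in the vertex ordering `v`. -/
def earlierNeighbors {W : Type*} (T : SimpleGraph W) {n : ℕ} (v : Fin n ≃ W) (i : Fin n) : Set W :=
  {w | T.Adj (v i) w ∧ v.symm w < i}

/-- The ordering `v` of all vertices of `T` is a construction sequence of `T` as a `k`-tree:
the first `k + 1` vertices form a `(k + 1)`-clique, and every later vertex is stacked onto a
`k`-clique of the graph constructed so far, i.e. its earlier neighbours form a `k`-clique. -/
structure IsConstructionSequence (k : ℕ) {W : Type*} (T : SimpleGraph W) {n : ℕ}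
    (v : Fin n ≃ W) : Prop where
  card_le : k + 1 ≤ n
  initial_clique : T.IsClique {w | (v.symm w : ℕ) ≤ k}
  stack_clique : ∀ i : Fin n, k < (i : ℕ) → T.IsClique (earlierNeighbors T v i)
  stack_card : ∀ i : Fin n, k < (i : ℕ) → (earlierNeighbors T v i).encard = k

/-- A simple `k`-tree: a `k`-tree with a construction sequence in which no two vertices are
stacked onto the same `k`-clique. -/
def IsSimpleKTree (k : ℕ) {W : Type*} (T : SimpleGraph W) : Prop :=
  ∃ (n : ℕ) (v : Fin n ≃ W), IsConstructionSequence k T v ∧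
    ∀ i j : Fin n, k < (i : ℕ) → k < (j : ℕ) →
      earlierNeighbors T v i = earlierNeighbors T v j → i = j

/-- A partial simple `k`-tree: a (not necessarily induced, not necessarily spanning) subgraph of
some simple `k`-tree. As `k`-trees are finite, their vertex set may be taken to be `Fin m`. -/
def IsPartialSimpleKTree (k : ℕ) {V : Type*} (G : SimpleGraph V) : Prop :=
  ∃ (m : ℕ) (T : SimpleGraph (Fin m)), IsSimpleKTree k T ∧ G.IsContained T

/-- The simple tree-width: the minimum `k` such that `G` is a partial simple `k`-tree. -/
noncomputable def simpleTreeWidth {V : Type*} (G : SimpleGraph V) : ℕ∞ :=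
  ⨅ (k : ℕ) (_ : IsPartialSimpleKTree k G), (k : ℕ∞)

/-- On finite graphs the minimum defining the simple tree-width is over a nonempty set. -/
theorem exists_isPartialSimpleKTree {V : Type*} [Finite V] (G : SimpleGraph V) :
    ∃ k, IsPartialSimpleKTree k G := by
  obtain ⟨k, ⟨e⟩⟩ := Finite.exists_equiv_fin V
  refine ⟨k, k + 1, ⊤, ⟨k + 1, Equiv.refl _, ⟨le_rfl, ?_, ?_, ?_⟩, ?_⟩, ⟨⟨?_, ?_⟩⟩⟩
  · intro a _ b _ hab
    exact hab
  · intro i hi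
    exact absurd i.isLt (by omega)
  · intro i hi
    exact absurd i.isLt (by omega)
  · intro i _ hi
    exact absurd i.isLt (by omega)
  · refine ⟨fun x => (e x).castSucc, ?_⟩
    intro a b hab
    simpa using hab.ne
  · intro a b hab
    simpa using hab

theorem simpleTreeWidth_ne_top {V : Type*} [Finite V] (G : SimpleGraph V) :
    simpleTreeWidth G ≠ ⊤ := by
  obtain ⟨k, hk⟩ := exists_isPartialSimpleKTree G
  exact ne_top_of_le_ne_top (ENat.natCast_ne_top k) (iInf₂_le k hk)

end SimpleTreeWidth

section Covers

/-- A class of (template) graphs. -/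
abbrev TemplateClass := ∀ ⦃U : Type u⦄, SimpleGraph U → Prop

/-- The disjoint union of a family of graphs. -/
def disjointUnion {ι : Type*} {U : ι → Type*} (T : ∀ i, SimpleGraph (U i)) :
    SimpleGraph (Σ i, U i) where
  Adj x y := ∃ (i : ι) (a b : U i), (T i).Adj a b ∧ x = ⟨i, a⟩ ∧ y = ⟨i, b⟩
  symm := ⟨by
    rintro x y ⟨i, a, b, h, hx, hy⟩
    exact ⟨i, b, a, h.symm, hy, hx⟩⟩
  loopless := ⟨by
    rintro x ⟨i, a, b, h, hx, hy⟩
    have hab : a = b := by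
      have hxy := hx.symm.trans hy
      simpa using hxy
    exact h.ne hab⟩

/-- A cover of `G` with respect to a template class: an edge-surjective homomorphism to `G` from
a disjoint union of finitely many finite template graphs. -/
structure Cover (𝒯 : TemplateClass.{u}) {V : Type u} (G : SimpleGraph V) where
  size : ℕ
  vertexType : Fin size → Type u
  finite_vertexType : ∀ i, Finite (vertexType i)
  template : ∀ i, SimpleGraph (vertexType i)
  template_mem : ∀ i, 𝒯 (template i)
  hom : disjointUnion template →g G
  edge_surjective : ∀ a b, G.Adj a b → ∃ x y, (disjointUnion template).Adj x y ∧
    hom x = a ∧ hom y = b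

/-- A cover is injective if its restriction to every template graph is injective. -/
def Cover.IsInjective {𝒯 : TemplateClass.{u}} {V : Type u} {G : SimpleGraph V}
    (φ : Cover 𝒯 G) : Prop :=
  ∀ i, Function.Injective fun a : φ.vertexType i => φ.hom ⟨i, a⟩

/-- The local covering number: the minimum, over all injective covers `φ` of `G`, of
`max_v |φ⁻¹(v)|`. -/
noncomputable def localCoveringNumber (𝒯 : TemplateClass.{u}) {V : Type u}
    (G : SimpleGraph V) : ℕ∞ :=
  ⨅ (φ : Cover 𝒯 G) (_ : φ.IsInjective), ⨆ v : V, {x | φ.hom x = v}.encard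

/-- Interval graphs: intersection graphs of (nonempty compact) real intervals. -/
def IsIntervalGraph : TemplateClass.{u} := fun U H =>
  ∃ l r : U → ℝ, (∀ a, l a ≤ r a) ∧
    ∀ a b, a ≠ b → (H.Adj a b ↔ (Set.Icc (l a) (r a) ∩ Set.Icc (l b) (r b)).Nonempty)

/-- The local track-number: the local covering number with respect to interval graphs. -/
noncomputable def localTrackNumber {V : Type u} (G : SimpleGraph V) : ℕ∞ :=
  localCoveringNumber IsIntervalGraph G

end Covers

/-!
A graph `G` contained in a simple `k`-tree `T` is covered by interval graphs while following a
construction sequence of `T`. Interval graphs are not closed under taking subgraphs, so the cover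
is built for `G` itself, and `T` only records the cliques onto which vertices are stacked.

Every vertex has a *home*, a layout of intervals in which part of its interval is free of all
others, so that arbitrarily many later neighbours can be attached to it there as small intervals.
Attaching a new vertex `u`, stacked onto a `k`-clique `C` of `T`, to each of its neighbours in `C`
separately takes up to `k` occurrences. If `u` misses a vertex of `C`, one more occurrence remains
for a home. If not, one occurrence must be saved, and there are two ways.

* Some part of the home of `a ∈ C` is covered exactly by `a` and another `b ∈ C` (`PairReady`).
  Then a single small interval placed there serves both `a` and `b`.
* Some `a ∈ C` is outermost in a layout (`EndReady`). Then `u` prolongs the layout beyond `a`,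
  which covers the edge `ua` and provides a home at once. This can be done only once, so the end
  must be reserved for `C`; simplicity of the `k`-tree enters here.

The invariant (`StackSystem`) is that every `k`-clique of `T` not yet used for stacking has a pair
or owns an end of its own. It survives each step (`StackSystem.exists_stack`): the new cliques
are the sets `C - w + u`.

* If `C` has a pair `a`, `b`, the pair serves those new cliques that contain both vertices. The
  other two receive the left and the right end of the new home of `u`.
* If `u` prolongs an end at `a`, the overlap of `u` and `a` is a pair for all new cliques containing
  `a`, and `C - a + u` owns the new end at `u`.
* If `C` owns an end at `a`, but `u` is not adjacent to `a`, a new clique containing a neighbour `w`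
  of `u` has the pair `w`, `u` in the home of `w`. All new cliques do if `u` has at least two
  neighbours in `C`; with one neighbour a single new clique lacks a pair, with none all `k` do. The
  `k - 1` or `k` occurrences of `u` not needed for its neighbours thus provide enough new ends.

In the beginning, `k` vertices with homes of their own form one `k`-set, onto which two vertices may
be stacked: the last one of the initial `(k + 1)`-clique and one later vertex. The two ends of one
home are reserved for them (`exists_stackSystem_twice`).
-/

/-! ### Layouts of intervals -/

/-- A family of compact real intervals indexed by `W`, given by their endpoints. An index whose
left endpoint exceeds its right endpoint has an empty interval and counts as absent. -/
abbrev Layout (W : Type*) := W → ℝ × ℝ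

namespace Layout

variable {W : Type*}

/-- The interval of `v`. -/
def span (I : Layout W) (v : W) : Set ℝ := Set.Icc (I v).1 (I v).2

/-- The vertex `v` is present in the layout, i.e. its interval is nonempty. -/
def Mem (I : Layout W) (v : W) : Prop := (I v).1 ≤ (I v).2

/-- The intervals of `a` and `b` intersect. -/
def Meets (I : Layout W) (a b : W) : Prop := (I.span a ∩ I.span b).Nonempty

/-- On some nonempty open interval of the line, the intervals present are exactly those
indexed by `X`. -/
def Spot (I : Layout W) (X : Set W) : Prop :=
  ∃ s t : ℝ, s < t ∧ ∀ x ∈ Set.Ioo s t, ∀ v, x ∈ I.span v ↔ v ∈ X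

/-- The mirror image of a layout. -/
def reflect (I : Layout W) : Layout W := fun v => (-(I v).2, -(I v).1)

/-- The interval of `a` is nondegenerate and reaches strictly further to the right than all
others. -/
def EndRight (I : Layout W) (a : W) : Prop :=
  (I a).1 < (I a).2 ∧ ∀ b, b ≠ a → I.Mem b → (I b).2 < (I a).2

/-- The interval of `a` is the outermost one on the right (`true`) or on the left (`false`). -/
def End (I : Layout W) : Bool → W → Prop
  | true, a => I.EndRight a
  | false, a => I.reflect.EndRight a

theorem Meets.symm {I : Layout W} {a b : W} (h : I.Meets a b) : I.Meets b a := by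
  rwa [Meets, Set.inter_comm]

theorem Meets.mem_left {I : Layout W} {a b : W} (h : I.Meets a b) : I.Mem a := by
  obtain ⟨x, hx, -⟩ := h
  exact hx.1.trans hx.2

theorem Meets.mem_right {I : Layout W} {a b : W} (h : I.Meets a b) : I.Mem b :=
  h.symm.mem_left

theorem meets_congr {I I' : Layout W} {a b : W} (ha : I' a = I a) (hb : I' b = I b) :
    I'.Meets a b ↔ I.Meets a b := by
  simp only [Meets, span, ha, hb]

theorem Spot.mem {I : Layout W} {X : Set W} (h : I.Spot X) {v : W} (hv : v ∈ X) : I.Mem v := by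
  obtain ⟨s, t, hst, h⟩ := h
  have := (h ((s + t) / 2) ⟨by linarith, by linarith⟩ v).2 hv
  exact this.1.trans this.2

theorem mem_reflect {I : Layout W} {v : W} : I.reflect.Mem v ↔ I.Mem v := by
  simp [Mem, reflect]

theorem End.mem {I : Layout W} {s : Bool} {a : W} (h : I.End s a) : I.Mem a := by
  cases s
  · exact mem_reflect.1 h.1.le
  · exact h.1.le

theorem reflect_reflect (I : Layout W) : I.reflect.reflect = I := by
  funext v
  simp [reflect]

theorem mem_span_reflect {I : Layout W} {v : W} {x : ℝ} :
    x ∈ I.reflect.span v ↔ -x ∈ I.span v := by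
  simp only [span, reflect, Set.mem_Icc]
  constructor <;> rintro ⟨h1, h2⟩ <;> constructor <;> linarith

theorem Meets.reflect {I : Layout W} {a b : W} (h : I.Meets a b) : I.reflect.Meets a b := by
  obtain ⟨x, hx, hy⟩ := h
  exact ⟨-x, mem_span_reflect.2 (by simpa using hx), mem_span_reflect.2 (by simpa using hy)⟩

theorem meets_reflect {I : Layout W} {a b : W} : I.reflect.Meets a b ↔ I.Meets a b :=
  ⟨fun h => by simpa [reflect_reflect] using h.reflect, Meets.reflect⟩

theorem Spot.reflect {I : Layout W} {X : Set W} (h : I.Spot X) : I.reflect.Spot X := by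
  obtain ⟨s, t, hst, h⟩ := h
  refine ⟨-t, -s, by linarith, fun x hx v => ?_⟩
  rw [mem_span_reflect]
  exact h _ ⟨by linarith [hx.2], by linarith [hx.1]⟩ v

theorem spot_reflect {I : Layout W} {X : Set W} : I.reflect.Spot X ↔ I.Spot X :=
  ⟨fun h => by simpa [reflect_reflect] using h.reflect, Spot.reflect⟩

theorem end_reflect {I : Layout W} {s : Bool} {a : W} : I.reflect.End s a ↔ I.End (!s) a := by
  cases s <;> simp [End, reflect_reflect]

/-- The layout `I'` arises from `I` by adding an interval for `u` that meets exactly the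
intervals indexed by `S`, without destroying any spot. All ends survive, except possibly
those on the side `j`. -/
structure Adds (I I' : Layout W) (u : W) (S : Set W) (j : Option Bool) : Prop where
  of_ne : ∀ v, v ≠ u → I' v = I v
  mem : I'.Mem u
  meets : ∀ v, v ≠ u → (I'.Meets u v ↔ v ∈ S)
  spot : ∀ X : Set W, X.Nonempty → I.Spot X → I'.Spot X
  new_spot : I'.Spot (insert u S)
  ends : ∀ s a, j ≠ some s → I.End s a → I'.End s a

theorem Adds.reflect {I I' : Layout W} {u : W} {S : Set W} {j : Option Bool}
    (h : Adds I I' u S j) : Adds I.reflect I'.reflect u S (j.map not) where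
  of_ne v hv := by simp [Layout.reflect, h.of_ne v hv]
  mem := mem_reflect.2 h.mem
  meets v hv := meets_reflect.trans (h.meets v hv)
  spot X hX hs := spot_reflect.2 (h.spot X hX (spot_reflect.1 hs))
  new_spot := spot_reflect.2 h.new_spot
  ends s a hs he := by
    refine end_reflect.2 (h.ends _ a ?_ (end_reflect.1 he))
    rintro rfl
    simp at hs

theorem Adds.meets_of_ne {I I' : Layout W} {u : W} {S : Set W} {j : Option Bool}
    (h : Adds I I' u S j) {a b : W} (ha : a ≠ u) (hb : b ≠ u) :
    I'.Meets a b ↔ I.Meets a b :=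
  meets_congr (h.of_ne a ha) (h.of_ne b hb)

theorem Adds.mem_of_ne {I I' : Layout W} {u : W} {S : Set W} {j : Option Bool}
    (h : Adds I I' u S j) {a : W} (ha : a ≠ u) : I'.Mem a ↔ I.Mem a := by
  simp only [Mem, h.of_ne a ha]

variable [DecidableEq W]

/-- A small interval can be added inside any nonempty spot. -/
theorem exists_adds_spot {I : Layout W} {u : W} {S : Set W} (hu : ¬ I.Mem u)
    (hS : S.Nonempty) (h : I.Spot S) : ∃ I', Adds I I' u S none := by
  have huS : u ∉ S := fun h' => hu (h.mem h')
  obtain ⟨s, t, hst, h⟩ := h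
  obtain ⟨c, hc⟩ := hS
  have hspan_u : ∀ x, x ∉ I.span u := fun x hx => hu (hx.1.trans hx.2)
  set p : ℝ × ℝ := (s + (t - s) / 3, s + 2 * (t - s) / 3) with hp
  have hu' : (Function.update I u p : Layout W) u = p := Function.update_self ..
  have hne : ∀ v, v ≠ u → (Function.update I u p : Layout W) v = I v :=
    fun v hv => Function.update_of_ne hv ..
  have hspan : ∀ v, v ≠ u → span (Function.update I u p) v = I.span v := by
    intro v hv
    simp only [span, hne v hv]
  have hspanu : span (Function.update I u p) u = Set.Icc p.1 p.2 := by
    simp only [span, hu']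
  have hsub : ∀ x ∈ Set.Icc p.1 p.2, x ∈ Set.Ioo s t := by
    intro x hx
    simp only [hp, Set.mem_Icc] at hx
    exact ⟨by linarith, by linarith⟩
  have hp12 : p.1 < p.2 := by simp only [hp]; linarith
  -- An interval covering the spot reaches beyond the new interval on both sides.
  have hcover : ∀ a, a ∈ S → (I a).1 < p.1 ∧ p.2 < (I a).2 := by
    intro a ha
    have h1 := (h (s + (t - s) / 6) ⟨by linarith, by linarith⟩ a).2 ha
    have h2 := (h (s + 5 * (t - s) / 6) ⟨by linarith, by linarith⟩ a).2 ha
    simp only [span, Set.mem_Icc] at h1 h2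
    simp only [hp]
    constructor <;> linarith
  have hmem : ∀ v, v ≠ u → (Mem (Function.update I u p) v ↔ I.Mem v) := by
    intro v hv
    simp only [Mem, hne v hv]
  refine ⟨Function.update I u p, hne, ?_, ?_, ?_, ?_, ?_⟩
  · simpa only [Mem, hu'] using hp12.le
  · intro v hv
    simp only [Meets, hspanu, hspan v hv]
    constructor
    · rintro ⟨x, hx, hxv⟩
      exact (h x (hsub x hx) v).1 hxv
    · intro hv
      have hx : p.1 ∈ Set.Icc p.1 p.2 := ⟨le_rfl, hp12.le⟩
      exact ⟨p.1, hx, (h _ (hsub _ hx) v).2 hv⟩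
  · rintro X hX ⟨s', t', hst', h'⟩
    by_cases hXS : X = S
    · subst hXS
      refine ⟨s, p.1, by simp only [hp]; linarith, fun x hx v => ?_⟩
      by_cases hv : v = u
      · subst hv
        simp only [hspanu, huS, iff_false, Set.mem_Icc, not_and_or, not_le]
        exact Or.inl hx.2
      · rw [hspan v hv]
        exact h x ⟨hx.1, hx.2.trans (hsub p.1 ⟨le_rfl, hp12.le⟩).2⟩ v
    · refine ⟨s', t', hst', fun x hx v => ?_⟩
      by_cases hv : v = u
      · subst hv
        have hvX : v ∉ X := fun hvX => hspan_u x ((h' x hx v).2 hvX)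
        simp only [hspanu, hvX, iff_false]
        intro hx'
        -- Spots with different index sets are disjoint.
        exact hXS (Set.ext fun w => (h' x hx w).symm.trans (h x (hsub x hx') w))
      · rw [hspan v hv]
        exact h' x hx v
  · refine ⟨p.1, p.2, hp12, fun x hx v => ?_⟩
    by_cases hv : v = u
    · subst hv
      simpa [hspanu] using ⟨hx.1.le, hx.2.le⟩
    · rw [hspan v hv]
      simpa [hv] using h x (hsub x ⟨hx.1.le, hx.2.le⟩) v
  · have hau : ∀ s a, I.End s a → a ≠ u := by
      rintro s a ha rfl
      exact hu ha.mem
    have hcI : I.Mem c := by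
      have := hcover c hc
      simp only [Mem]
      linarith
    intro s a _ ha
    have hau := hau s a ha
    cases s
    · obtain ⟨h1, h2⟩ := ha
      refine ⟨by simpa only [Layout.reflect, hne a hau] using h1, fun b hb hbm => ?_⟩
      by_cases hbu : b = u
      · subst hbu
        simp only [Layout.reflect, hu', hne a hau]
        have hle : (I a).1 ≤ (I c).1 := by
          by_cases hca : c = a
          · rw [hca]
          · have := h2 c hca (mem_reflect.2 hcI)
            simp only [Layout.reflect] at this
            linarith
        linarith [(hcover c hc).1]
      · have := h2 b hb (mem_reflect.2 ((hmem b hbu).1 (mem_reflect.1 hbm)))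
        simpa only [Layout.reflect, hne a hau, hne b hbu] using this
    · obtain ⟨h1, h2⟩ := ha
      refine ⟨by simpa only [hne a hau] using h1, fun b hb hbm => ?_⟩
      by_cases hbu : b = u
      · subst hbu
        simp only [hu', hne a hau]
        have hle : (I c).2 ≤ (I a).2 := by
          by_cases hca : c = a
          · rw [hca]
          · exact (h2 c hca hcI).le
        linarith [(hcover c hc).2]
      · simpa only [hne a hau, hne b hbu] using h2 b hb ((hmem b hbu).1 hbm)

/-- An interval added to an empty layout is outermost on both sides. -/
theorem exists_adds_empty {I : Layout W} {u : W} (h : ∀ v, ¬ I.Mem v) :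
    ∃ I', Adds I I' u ∅ none ∧ ∀ s, I'.End s u := by
  have hu' : (Function.update I u (0, 1) : Layout W) u = (0, 1) := Function.update_self ..
  have hne : ∀ v, v ≠ u → (Function.update I u (0, 1) : Layout W) v = I v :=
    fun v hv => Function.update_of_ne hv ..
  have hmem : ∀ v, v ≠ u → ¬ Mem (Function.update I u (0, 1)) v := by
    intro v hv
    simpa only [Mem, hne v hv] using h v
  refine ⟨Function.update I u (0, 1), ⟨hne, ?_, ?_, ?_, ?_, ?_⟩, ?_⟩
  · simp [Mem]
  · intro v hv
    simp only [Set.mem_empty_iff_false, iff_false]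
    exact fun hm => hmem v hv hm.mem_right
  · rintro X ⟨v, hv⟩ hX
    exact absurd (hX.mem hv) (h v)
  · refine ⟨0, 1, one_pos, fun x hx v => ?_⟩
    by_cases hv : v = u
    · subst hv
      simpa [span, hu'] using ⟨hx.1.le, hx.2.le⟩
    · simp only [insert_empty_eq, Set.mem_singleton_iff, hv, iff_false]
      exact fun hx' => hmem v hv (hx'.1.trans hx'.2)
  · intro s a _ ha
    exact absurd ha.mem (h a)
  · intro s
    cases s
    · exact ⟨by simp [Layout.reflect],
        fun b hb hbm => absurd (mem_reflect.1 hbm) (hmem b hb)⟩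
    · exact ⟨by simp, fun b hb hbm => absurd hbm (hmem b hb)⟩

theorem exists_adds_endRight [Finite W] {I : Layout W} {u a : W} (hu : ¬ I.Mem u)
    (ha : I.EndRight a) :
    ∃ I', Adds I I' u {a} (some true) ∧ I'.Spot {u} ∧ I'.EndRight u := by
  obtain ⟨ha1, ha2⟩ := ha
  have hau : a ≠ u := by
    rintro rfl
    exact hu ha1.le
  -- A point `q` of the interval of `a` to the right of all other intervals.
  obtain ⟨q, hq1, hq2, hq3⟩ : ∃ q, (I a).1 < q ∧ q < (I a).2 ∧
      ∀ b, b ≠ a → I.Mem b → (I b).2 < q := by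
    have hfin : {x | x = (I a).1 ∨ ∃ b, (b ≠ a ∧ I.Mem b) ∧ (I b).2 = x}.Finite :=
      (Set.finite_singleton (I a).1).union
        ((Set.toFinite {b | b ≠ a ∧ I.Mem b}).image fun b => (I b).2)
    obtain ⟨m, hm, hmax⟩ := hfin.exists_maximalFor id _ ⟨_, Or.inl rfl⟩
    have hle : ∀ x, (x = (I a).1 ∨ ∃ b, (b ≠ a ∧ I.Mem b) ∧ (I b).2 = x) → x ≤ m := by
      intro x hx
      rcases le_total m x with h | h
      · exact hmax hx h
      · exact h
    have hma : m < (I a).2 := by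
      rcases hm with rfl | ⟨b, ⟨hb1, hb2⟩, rfl⟩
      · exact ha1
      · exact ha2 b hb1 hb2
    refine ⟨(m + (I a).2) / 2, ?_, by linarith, fun b hb hbm => ?_⟩
    · linarith [hle _ (Or.inl rfl)]
    · linarith [hle _ (Or.inr ⟨b, ⟨hb, hbm⟩, rfl⟩)]
  -- The new interval starts strictly between `q` and the right end of `a`, so that `a` keeps a
  -- part of its own.
  set p : ℝ × ℝ := ((q + (I a).2) / 2, (I a).2 + 1) with hp
  have hu' : (Function.update I u p : Layout W) u = p := Function.update_self ..
  have hne : ∀ v, v ≠ u → (Function.update I u p : Layout W) v = I v :=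
    fun v hv => Function.update_of_ne hv ..
  have hspan : ∀ v, v ≠ u → span (Function.update I u p) v = I.span v := by
    intro v hv
    simp only [span, hne v hv]
  have hspanu : span (Function.update I u p) u = Set.Icc p.1 p.2 := by
    simp only [span, hu']
  have hmem : ∀ v, v ≠ u → (Mem (Function.update I u p) v ↔ I.Mem v) := by
    intro v hv
    simp only [Mem, hne v hv]
  have hqp : q < p.1 := by simp only [hp]; linarith
  have hpa : p.1 < (I a).2 := by simp only [hp]; linarith
  have hap : (I a).2 < p.2 := by simp only [hp]; linarith
  have hleft : ∀ b, b ≠ a → ∀ x, q ≤ x → x ∉ I.span b := by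
    intro b hb x hx hxb
    linarith [hq3 b hb (hxb.1.trans hxb.2), hxb.2]
  have hspot : ∀ x, q < x → x < p.1 → ∀ v,
      x ∈ span (Function.update I u p) v ↔ v ∈ ({a} : Set W) := by
    intro x hx1 hx2 v
    by_cases hv : v = u
    · subst hv
      simp only [hspanu, Set.mem_singleton_iff, hau.symm, iff_false]
      exact fun hx => by linarith [hx.1]
    · rw [hspan v hv]
      by_cases hva : v = a
      · subst hva
        simp only [span, Set.mem_Icc, Set.mem_singleton_iff, iff_true]
        constructor <;> linarith
      · simp only [Set.mem_singleton_iff, hva, iff_false]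
        exact hleft v hva x hx1.le
  refine ⟨Function.update I u p, ⟨hne, ?_, ?_, ?_, ?_, ?_⟩, ?_, ?_⟩
  · simp only [Mem, hu']
    linarith
  · intro v hv
    simp only [Meets, hspanu, hspan v hv, Set.mem_singleton_iff]
    constructor
    · rintro ⟨x, hx, hxv⟩
      by_contra hva
      exact hleft v hva x (by linarith [hx.1]) hxv
    · rintro rfl
      exact ⟨p.1, ⟨le_rfl, by linarith⟩, by linarith, by linarith⟩
  · rintro X ⟨c, hc⟩ ⟨s, t, hst, h⟩
    by_cases hsp : s < p.1
    · refine ⟨s, min t p.1, lt_min hst hsp, fun x hx v => ?_⟩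
      have hxt : x ∈ Set.Ioo s t := ⟨hx.1, hx.2.trans_le (min_le_left _ _)⟩
      have hxp : x < p.1 := hx.2.trans_le (min_le_right _ _)
      by_cases hv : v = u
      · subst hv
        rw [hspanu]
        refine iff_of_false (fun hx' => by linarith [hx'.1]) fun hvX => hu ?_
        have := (h x hxt v).2 hvX
        exact this.1.trans this.2
      · rw [hspan v hv]
        exact h x hxt v
    · -- Right of the start of the new interval only `a` was present, and `a` has another spot.
      have key : ∀ v ∈ X, v = a := by
        intro v hv
        by_contra hva
        exact hleft v hva ((s + t) / 2) (by linarith)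
          ((h _ ⟨by linarith, by linarith⟩ v).2 hv)
      have hX : X = {a} := Set.eq_singleton_iff_unique_mem.2 ⟨key c hc ▸ hc, key⟩
      subst hX
      exact ⟨q, p.1, hqp, fun x hx => hspot x hx.1 hx.2⟩
  · refine ⟨p.1, (I a).2, hpa, fun x hx v => ?_⟩
    by_cases hv : v = u
    · subst hv
      simp only [hspanu, Set.mem_Icc, Set.mem_insert_iff, true_or, iff_true]
      exact ⟨hx.1.le, by linarith [hx.2]⟩
    · rw [hspan v hv]
      by_cases hva : v = a
      · subst hva
        simp only [span, Set.mem_Icc, Set.mem_insert_iff, Set.mem_singleton_iff, or_true,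
          iff_true]
        constructor <;> linarith [hx.1, hx.2]
      · simp only [Set.mem_insert_iff, Set.mem_singleton_iff, hva, hv, or_self, iff_false]
        exact hleft v hva x (by linarith [hx.1])
  · intro s b hs hb
    cases s
    · have hbu : b ≠ u := by
        rintro rfl
        exact hu (End.mem hb)
      obtain ⟨h1, h2⟩ := hb
      refine ⟨by simpa only [Layout.reflect, hne b hbu] using h1, fun c hcb hcm => ?_⟩
      by_cases hcu : c = u
      · subst hcu
        simp only [Layout.reflect, hu', hne b hbu]
        simp only [Layout.reflect] at h1
        have : (I b).1 < p.1 := by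
          by_cases hba : b = a
          · subst hba
            linarith
          · linarith [hq3 b hba (by simp only [Mem]; linarith)]
        linarith
      · have := h2 c hcb (mem_reflect.2 ((hmem c hcu).1 (mem_reflect.1 hcm)))
        simpa only [Layout.reflect, hne b hbu, hne c hcu] using this
    · simp at hs
  · refine ⟨(I a).2, p.2, hap, fun x hx v => ?_⟩
    by_cases hv : v = u
    · subst hv
      simp only [hspanu, Set.mem_Icc, Set.mem_singleton_iff, iff_true]
      exact ⟨by linarith [hx.1], hx.2.le⟩
    · rw [hspan v hv]
      simp only [Set.mem_singleton_iff, hv, iff_false]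
      by_cases hva : v = a
      · subst hva
        exact fun hx' => by linarith [hx.1, hx'.2]
      · exact hleft v hva x (by linarith [hx.1])
  · refine ⟨by simp only [hu']; linarith, fun b hb hbm => ?_⟩
    simp only [hu', hne b hb]
    by_cases hba : b = a
    · subst hba
      exact hap
    · linarith [hq3 b hba ((hmem b hb).1 hbm)]

/-- An outermost interval can be prolonged by a new one, which becomes outermost in its place. -/
theorem exists_adds_end [Finite W] {I : Layout W} {u a : W} {s : Bool} (hu : ¬ I.Mem u)
    (ha : I.End s a) :
    ∃ I', Adds I I' u {a} (some s) ∧ I'.Spot {u} ∧ I'.End s u := by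
  cases s
  · obtain ⟨I', h1, h2, h3⟩ := exists_adds_endRight (mt mem_reflect.1 hu) ha
    refine ⟨I'.reflect, ?_, h2.reflect, ?_⟩
    · simpa [reflect_reflect] using h1.reflect
    · simpa [End, reflect_reflect] using h3
  · exact exists_adds_endRight hu ha

end Layout

/-! ### Systems of layouts -/

section TrackSystem

open Layout

variable {W : Type*}

/-- A family of layouts covering the edges of `G` between the vertices of `P`, in which every
vertex occurs at most `k` times. Layouts are indexed by pairs of vertices; those whose index
starts with a vertex outside `P` are empty and serve as a supply of new layouts. The vertex `v`
has a home, the layout `h v`, in which some part of its interval is disjoint from all others. -/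
structure TrackSystem (G : SimpleGraph W) (k : ℕ) (P : Finset W) (I : W × W → Layout W)
    (h : W → W × W) : Prop where
  adj : ∀ J a b, a ≠ b → (I J).Meets a b → G.Adj a b
  cover : ∀ a ∈ P, ∀ b ∈ P, G.Adj a b → ∃ J, (I J).Meets a b
  mem : ∀ J v, (I J).Mem v → v ∈ P ∧ J.1 ∈ P
  card : ∀ v, {J | (I J).Mem v}.encard ≤ k
  home : ∀ v ∈ P, (I (h v)).Spot {v}

variable {G : SimpleGraph W} {k : ℕ} {P : Finset W} {I I' : W × W → Layout W}
  {h : W → W × W} {u : W}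

theorem TrackSystem.home_fst_mem (hs : TrackSystem G k P I h) {v : W} (hv : v ∈ P) :
    (h v).1 ∈ P :=
  (hs.mem _ v ((hs.home v hv).mem rfl)).2

variable [DecidableEq W]

theorem TrackSystem.add (hs : TrackSystem G k P I h) (hu : u ∉ P) (D : Finset (W × W))
    (S : W × W → Set W) (hD : ∀ J ∈ D, ∃ j, Adds (I J) (I' J) u (S J) j)
    (hD' : ∀ J, J ∉ D → I' J = I J) (hcard : D.card ≤ k)
    (hS : ∀ J ∈ D, ∀ w ∈ S J, G.Adj u w) (hcov : ∀ w ∈ P, G.Adj u w → ∃ J ∈ D, w ∈ S J)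
    (hidx : ∀ J ∈ D, J.1 ∈ insert u P) {J₀ : W × W} (hJ₀ : (I' J₀).Spot {u}) :
    TrackSystem G k (insert u P) I' (Function.update h u J₀) := by
  have huI : ∀ J, ¬ (I J).Mem u := fun J hm => hu (hs.mem J u hm).1
  have hmem : ∀ J v, v ≠ u → ((I' J).Mem v ↔ (I J).Mem v) := by
    intro J v hv
    by_cases hJ : J ∈ D
    · obtain ⟨j, hj⟩ := hD J hJ
      exact hj.mem_of_ne hv
    · rw [hD' J hJ]
  have hmeets : ∀ J a b, a ≠ u → b ≠ u → ((I' J).Meets a b ↔ (I J).Meets a b) := by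
    intro J a b ha hb
    by_cases hJ : J ∈ D
    · obtain ⟨j, hj⟩ := hD J hJ
      exact hj.meets_of_ne ha hb
    · rw [hD' J hJ]
  have hmemu : ∀ J, (I' J).Mem u → J ∈ D := by
    intro J hm
    by_contra hJ
    rw [hD' J hJ] at hm
    exact huI J hm
  have hmeetsu : ∀ J b, b ≠ u → (I' J).Meets u b → G.Adj u b := by
    intro J b hb hm
    have hJ := hmemu J hm.mem_left
    obtain ⟨j, hj⟩ := hD J hJ
    exact hS J hJ b ((hj.meets b hb).1 hm)
  have hcovu : ∀ b ∈ insert u P, G.Adj u b → ∃ J, (I' J).Meets u b := by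
    intro b hb hub
    obtain ⟨J, hJ, hbS⟩ := hcov b (Finset.mem_of_mem_insert_of_ne hb hub.ne') hub
    obtain ⟨j, hj⟩ := hD J hJ
    exact ⟨J, (hj.meets b hub.ne').2 hbS⟩
  refine ⟨?_, ?_, ?_, ?_, ?_⟩
  · intro J a b hab hm
    by_cases ha : a = u
    · subst ha
      exact hmeetsu J b hab.symm hm
    by_cases hb : b = u
    · subst hb
      exact (hmeetsu J a hab hm.symm).symm
    exact hs.adj J a b hab ((hmeets J a b ha hb).1 hm)
  · intro a ha b hb hab
    by_cases hau : a = u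
    · subst hau
      exact hcovu b hb hab
    by_cases hbu : b = u
    · subst hbu
      obtain ⟨J, hJ⟩ := hcovu a ha hab.symm
      exact ⟨J, hJ.symm⟩
    obtain ⟨J, hJ⟩ := hs.cover a (Finset.mem_of_mem_insert_of_ne ha hau) b
      (Finset.mem_of_mem_insert_of_ne hb hbu) hab
    exact ⟨J, (hmeets J a b hau hbu).2 hJ⟩
  · intro J v hv
    by_cases hvu : v = u
    · subst hvu
      exact ⟨Finset.mem_insert_self _ _, hidx J (hmemu J hv)⟩
    · have := hs.mem J v ((hmem J v hvu).1 hv)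
      exact ⟨Finset.mem_insert_of_mem this.1, Finset.mem_insert_of_mem this.2⟩
  · intro v
    by_cases hvu : v = u
    · subst hvu
      calc {J | (I' J).Mem v}.encard ≤ (D : Set (W × W)).encard :=
            Set.encard_le_encard fun J hJ => hmemu J hJ
        _ = D.card := Set.encard_coe_eq_coe_finsetCard D
        _ ≤ k := by exact_mod_cast hcard
    · simpa only [hmem _ v hvu] using hs.card v
  · intro v hv
    by_cases hvu : v = u
    · subst hvu
      simpa using hJ₀
    · rw [Function.update_of_ne hvu]
      have hsp := hs.home v (Finset.mem_of_mem_insert_of_ne hv hvu)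
      by_cases hJ : h v ∈ D
      · obtain ⟨j, hj⟩ := hD _ hJ
        exact hj.spot _ (Set.singleton_nonempty v) hsp
      · rwa [hD' _ hJ]

theorem exists_layouts (D : Finset (W × W)) {R : W × W → Layout W → Prop}
    (hR : ∀ J ∈ D, ∃ I', R J I') :
    ∃ I' : W × W → Layout W, (∀ J ∈ D, R J (I' J)) ∧ ∀ J, J ∉ D → I' J = I J := by
  have : ∀ J, ∃ I', (J ∈ D → R J I') ∧ (J ∉ D → I' = I J) := by
    intro J
    by_cases hJ : J ∈ D
    · obtain ⟨I', hI'⟩ := hR J hJ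
      exact ⟨I', fun _ => hI', fun h' => absurd hJ h'⟩
    · exact ⟨I J, fun h' => absurd h' hJ, fun _ => rfl⟩
  choose I' hI' using this
  exact ⟨I', fun J => (hI' J).1, fun J => (hI' J).2⟩

/-- A vertex `u` with fewer than `k` neighbours, all having different homes, is added in a
private part of each neighbour and alone in new layouts. -/
theorem TrackSystem.exists_add_leaf (hs : TrackSystem G k P I h) (hu : u ∉ P) {E : Finset W}
    (hEP : E ⊆ P) (hE : ∀ w ∈ P, G.Adj u w ↔ w ∈ E) (hinj : Set.InjOn h E) {F : Finset W}
    {w₀ : W} (hw₀ : w₀ ∈ F) (hcard : E.card + F.card ≤ k) :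
    ∃ I', TrackSystem G k (insert u P) I' (Function.update h u (u, w₀)) ∧
      (∀ J X, X.Nonempty → (I J).Spot X → (I' J).Spot X) ∧
      (∀ J s a, (I J).End s a → (I' J).End s a) ∧
      (∀ w ∈ E, (I' (h w)).Spot {w, u}) ∧ ∀ w ∈ F, ∀ s, (I' (u, w)).End s u := by
  have huI : ∀ J, ¬ (I J).Mem u := fun J hm => hu (hs.mem J u hm).1
  have hnew : ∀ w v, ¬ (I (u, w)).Mem v := fun w v hm => hu (hs.mem _ v hm).2
  have hhu : ∀ w ∈ E, ∀ x, h w ≠ (u, x) := by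
    intro w hw x hwx
    have := hs.home_fst_mem (hEP hw)
    rw [hwx] at this
    exact hu this
  set D := E.image h ∪ F.image (fun w => (u, w)) with hDdef
  have hDcard : D.card ≤ k :=
    (Finset.card_union_le _ _).trans
      ((add_le_add Finset.card_image_le Finset.card_image_le).trans hcard)
  set S : W × W → Set W := fun J => {w | w ∈ E ∧ h w = J} with hSdef
  have hSh : ∀ w ∈ E, S (h w) = {w} := by
    intro w hw
    ext x
    refine ⟨fun hx => hinj hx.1 hw hx.2, ?_⟩
    rintro rfl
    exact ⟨hw, rfl⟩
  have hSu : ∀ w, S (u, w) = ∅ := by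
    intro w
    ext x
    exact ⟨fun hx => hhu x hx.1 w hx.2, fun hx => hx.elim⟩
  obtain ⟨I', hI', hI'2⟩ := exists_layouts (I := I) D
    (R := fun J I' => Adds (I J) I' u (S J) none ∧ (J.1 = u → ∀ s, I'.End s u)) (by
      intro J hJ
      rcases Finset.mem_union.1 hJ with hJ | hJ
      · obtain ⟨w, hw, rfl⟩ := Finset.mem_image.1 hJ
        rw [hSh w hw]
        obtain ⟨I', hI'⟩ := exists_adds_spot (huI _) (Set.singleton_nonempty w)
          (hs.home w (hEP hw))
        refine ⟨I', hI', fun h' => (hhu w hw (h w).2 (Prod.ext h' rfl)).elim⟩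
      · obtain ⟨w, hw, rfl⟩ := Finset.mem_image.1 hJ
        rw [hSu]
        obtain ⟨I', hI', he⟩ := exists_adds_empty (u := u) (hnew w)
        exact ⟨I', hI', fun _ => he⟩)
  have hFD : ∀ w ∈ F, (u, w) ∈ D := fun w hw =>
    Finset.mem_union_right _ (Finset.mem_image_of_mem _ hw)
  have hED : ∀ w ∈ E, h w ∈ D := fun w hw =>
    Finset.mem_union_left _ (Finset.mem_image_of_mem _ hw)
  refine ⟨I', ?_, ?_, ?_, ?_, ?_⟩
  · refine hs.add hu D S (fun J hJ => ⟨_, (hI' J hJ).1⟩) hI'2 hDcard ?_ ?_ ?_ ?_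
    · exact fun J _ w hw => (hE w (hEP hw.1)).2 hw.1
    · exact fun w hw huw => ⟨h w, hED w ((hE w hw).1 huw), (hE w hw).1 huw, rfl⟩
    · intro J hJ
      rcases Finset.mem_union.1 hJ with hJ | hJ
      · obtain ⟨w, hw, rfl⟩ := Finset.mem_image.1 hJ
        exact Finset.mem_insert_of_mem (hs.home_fst_mem (hEP hw))
      · obtain ⟨w, hw, rfl⟩ := Finset.mem_image.1 hJ
        exact Finset.mem_insert_self _ _
    · simpa [hSu] using (hI' _ (hFD w₀ hw₀)).1.new_spot
  · intro J X hX hsp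
    by_cases hJ : J ∈ D
    · exact (hI' J hJ).1.spot X hX hsp
    · rwa [hI'2 J hJ]
  · intro J s a he
    by_cases hJ : J ∈ D
    · exact (hI' J hJ).1.ends s a (by simp) he
    · rwa [hI'2 J hJ]
  · intro w hw
    have := (hI' _ (hED w hw)).1.new_spot
    rwa [hSh w hw, Set.pair_comm] at this
  · exact fun w hw => (hI' _ (hFD w hw)).2 rfl

/-- A vertex `u` adjacent to two vertices `a`, `b` with a spot of their own is added in that spot,
in a private part of each other neighbour, and alone in a new layout. -/
theorem TrackSystem.exists_add_pair (hs : TrackSystem G k P I h) (hu : u ∉ P) {E : Finset W}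
    (hEP : E ⊆ P) (hE : ∀ w ∈ P, G.Adj u w ↔ w ∈ E) (hcard : E.card ≤ k) {a b : W}
    (ha : a ∈ E) (hb : b ∈ E) (hab : a ≠ b) (hinj : Set.InjOn h (E.erase b))
    (hsp : (I (h a)).Spot {a, b}) :
    ∃ I', TrackSystem G k (insert u P) I' (Function.update h u (u, u)) ∧
      (∀ J X, X.Nonempty → (I J).Spot X → (I' J).Spot X) ∧
      (∀ J s a, (I J).End s a → (I' J).End s a) ∧ ∀ s, (I' (u, u)).End s u := by
  have huI : ∀ J, ¬ (I J).Mem u := fun J hm => hu (hs.mem J u hm).1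
  have hnew : ∀ w v, ¬ (I (u, w)).Mem v := fun w v hm => hu (hs.mem _ v hm).2
  have hhu : ∀ w ∈ E, ∀ x, h w ≠ (u, x) := by
    intro w hw x hwx
    have := hs.home_fst_mem (hEP hw)
    rw [hwx] at this
    exact hu this
  have haE : a ∈ E.erase b := Finset.mem_erase.2 ⟨hab, ha⟩
  set D := insert (u, u) ((E.erase b).image h) with hDdef
  have hDcard : D.card ≤ k := by
    have h1 : D.card ≤ _ := Finset.card_insert_le (u, u) ((E.erase b).image h)
    have h2 : ((E.erase b).image h).card ≤ (E.erase b).card := Finset.card_image_le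
    have h3 := Finset.card_erase_add_one hb
    omega
  set S : W × W → Set W := fun J => {w | w ∈ E ∧ h (if w = b then a else w) = J} with hSdef
  have hSa : S (h a) = {a, b} := by
    ext x
    simp only [hSdef, Set.mem_ofPred_eq, Set.mem_insert_iff, Set.mem_singleton_iff]
    constructor
    · rintro ⟨hx, hxa⟩
      by_cases hxb : x = b
      · exact Or.inr hxb
      · rw [if_neg hxb] at hxa
        exact Or.inl (hinj (Finset.mem_coe.2 (Finset.mem_erase.2 ⟨hxb, hx⟩)) haE hxa)
    · rintro (rfl | rfl)
      · exact ⟨ha, by rw [if_neg hab]⟩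
      · exact ⟨hb, by rw [if_pos rfl]⟩
  have hSh : ∀ w ∈ E.erase b, w ≠ a → S (h w) = {w} := by
    intro w hw hwa
    ext x
    simp only [hSdef, Set.mem_ofPred_eq, Set.mem_singleton_iff]
    constructor
    · rintro ⟨hx, hxw⟩
      by_cases hxb : x = b
      · rw [if_pos hxb] at hxw
        exact absurd (hinj hw haE hxw.symm) hwa
      · rw [if_neg hxb] at hxw
        exact hinj (Finset.mem_coe.2 (Finset.mem_erase.2 ⟨hxb, hx⟩)) hw hxw
    · rintro rfl
      exact ⟨Finset.mem_of_mem_erase hw, by rw [if_neg (Finset.ne_of_mem_erase hw)]⟩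
  have hSE : ∀ x ∈ E, (if x = b then a else x) ∈ E.erase b := by
    intro x hx
    split_ifs with hxb
    · exact haE
    · exact Finset.mem_erase.2 ⟨hxb, hx⟩
  have hSu : ∀ w, S (u, w) = ∅ := by
    intro w
    ext x
    exact ⟨fun hx => hhu _ (Finset.mem_of_mem_erase (hSE x hx.1)) w hx.2, fun hx => hx.elim⟩
  obtain ⟨I', hI', hI'2⟩ := exists_layouts (I := I) D
    (R := fun J I' => Adds (I J) I' u (S J) none ∧ (J.1 = u → ∀ s, I'.End s u)) (by
      intro J hJ
      rcases Finset.mem_insert.1 hJ with rfl | hJ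
      · rw [hSu]
        obtain ⟨I', hI', he⟩ := exists_adds_empty (u := u) (hnew u)
        exact ⟨I', hI', fun _ => he⟩
      · obtain ⟨w, hw, rfl⟩ := Finset.mem_image.1 hJ
        have hwE := Finset.mem_of_mem_erase hw
        have : ∃ I', Adds (I (h w)) I' u (S (h w)) none := by
          by_cases hwa : w = a
          · subst hwa
            rw [hSa]
            exact exists_adds_spot (huI _) (Set.insert_nonempty _ _) hsp
          · rw [hSh w hw hwa]
            exact exists_adds_spot (huI _) (Set.singleton_nonempty w) (hs.home w (hEP hwE))
        obtain ⟨I', hI'⟩ := this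
        exact ⟨I', hI', fun h' => (hhu w hwE (h w).2 (Prod.ext h' rfl)).elim⟩)
  have huD : (u, u) ∈ D := Finset.mem_insert_self _ _
  have hED : ∀ w ∈ E.erase b, h w ∈ D := fun w hw =>
    Finset.mem_insert_of_mem (Finset.mem_image_of_mem _ hw)
  refine ⟨I', ?_, ?_, ?_, ?_⟩
  · refine hs.add hu D S (fun J hJ => ⟨_, (hI' J hJ).1⟩) hI'2 hDcard ?_ ?_ ?_ ?_
    · exact fun J _ w hw => (hE w (hEP hw.1)).2 hw.1
    · exact fun w hw huw =>
        ⟨_, hED _ (hSE w ((hE w hw).1 huw)), (hE w hw).1 huw, rfl⟩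
    · intro J hJ
      rcases Finset.mem_insert.1 hJ with rfl | hJ
      · exact Finset.mem_insert_self _ _
      · obtain ⟨w, hw, rfl⟩ := Finset.mem_image.1 hJ
        exact Finset.mem_insert_of_mem (hs.home_fst_mem (hEP (Finset.mem_of_mem_erase hw)))
    · simpa [hSu] using (hI' _ huD).1.new_spot
  · intro J X hX hsp
    by_cases hJ : J ∈ D
    · exact (hI' J hJ).1.spot X hX hsp
    · rwa [hI'2 J hJ]
  · intro J s a he
    by_cases hJ : J ∈ D
    · exact (hI' J hJ).1.ends s a (by simp) he
    · rwa [hI'2 J hJ]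
  · exact (hI' _ huD).2 rfl

/-- A vertex `u` adjacent to a vertex `a` that is outermost in the layout `J` is added there
beyond `a`, and in a private part of each other neighbour. -/
theorem TrackSystem.exists_add_end [Finite W] (hs : TrackSystem G k P I h) (hu : u ∉ P)
    {E : Finset W} (hEP : E ⊆ P) (hE : ∀ w ∈ P, G.Adj u w ↔ w ∈ E) (hcard : E.card ≤ k) {a : W}
    (ha : a ∈ E) (hinj : Set.InjOn h E) {J : W × W} {s : Bool} (he : (I J).End s a)
    (hJ : ∀ w ∈ E, w ≠ a → h w ≠ J) :
    ∃ I', TrackSystem G k (insert u P) I' (Function.update h u J) ∧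
      (∀ J X, X.Nonempty → (I J).Spot X → (I' J).Spot X) ∧
      (∀ K r b, (K, r) ≠ (J, s) → (I K).End r b → (I' K).End r b) ∧
      (I' J).Spot {u, a} ∧ (I' J).End s u := by
  have huI : ∀ J, ¬ (I J).Mem u := fun J hm => hu (hs.mem J u hm).1
  set D := insert J ((E.erase a).image h) with hDdef
  have hDcard : D.card ≤ k := by
    have h1 : D.card ≤ _ := Finset.card_insert_le J ((E.erase a).image h)
    have h2 : ((E.erase a).image h).card ≤ (E.erase a).card := Finset.card_image_le
    have h3 := Finset.card_erase_add_one ha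
    omega
  set S : W × W → Set W := fun K => {w | w ∈ E ∧ (if w = a then J else h w) = K} with hSdef
  have hSJ : S J = {a} := by
    ext x
    simp only [hSdef, Set.mem_ofPred_eq, Set.mem_singleton_iff]
    constructor
    · rintro ⟨hx, hxJ⟩
      by_contra hxa
      rw [if_neg hxa] at hxJ
      exact hJ x hx hxa hxJ
    · rintro rfl
      exact ⟨ha, by rw [if_pos rfl]⟩
  have hSh : ∀ w ∈ E.erase a, S (h w) = {w} := by
    intro w hw
    obtain ⟨hwa, hwE⟩ := Finset.mem_erase.1 hw
    ext x
    simp only [hSdef, Set.mem_ofPred_eq, Set.mem_singleton_iff]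
    constructor
    · rintro ⟨hx, hxw⟩
      by_cases hxa : x = a
      · rw [if_pos hxa] at hxw
        exact absurd hxw.symm (hJ w hwE hwa)
      · rw [if_neg hxa] at hxw
        exact hinj hx hwE hxw
    · rintro rfl
      exact ⟨hwE, by rw [if_neg hwa]⟩
  obtain ⟨I', hI', hI'2⟩ := exists_layouts (I := I) D
    (R := fun K I' => Adds (I K) I' u (S K) (if K = J then some s else none) ∧
      (K = J → I'.Spot {u} ∧ I'.End s u)) (by
      intro K hK
      by_cases hKJ : K = J
      · subst hKJ
        obtain ⟨I', h1, h2, h3⟩ := exists_adds_end (huI K) he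
        exact ⟨I', by simpa [hSJ] using h1, fun _ => ⟨h2, h3⟩⟩
      · obtain ⟨w, hw, rfl⟩ := Finset.mem_image.1 (Finset.mem_of_mem_insert_of_ne hK hKJ)
        obtain ⟨I', hI'⟩ := exists_adds_spot (huI (h w)) (Set.singleton_nonempty w)
          (hs.home w (hEP (Finset.mem_of_mem_erase hw)))
        exact ⟨I', by simpa [hSh w hw, hKJ] using hI', fun h' => absurd h' hKJ⟩)
  have hJD : J ∈ D := Finset.mem_insert_self _ _
  refine ⟨I', ?_, ?_, ?_, ?_, ((hI' J hJD).2 rfl).2⟩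
  · refine hs.add hu D S (fun J hJ => ⟨_, (hI' J hJ).1⟩) hI'2 hDcard ?_ ?_ ?_
      ((hI' J hJD).2 rfl).1
    · exact fun J _ w hw => (hE w (hEP hw.1)).2 hw.1
    · intro w hw huw
      have hwE := (hE w hw).1 huw
      refine ⟨_, ?_, hwE, rfl⟩
      split_ifs with hwa
      · exact hJD
      · exact Finset.mem_insert_of_mem
          (Finset.mem_image_of_mem _ (Finset.mem_erase.2 ⟨hwa, hwE⟩))
    · intro K hK
      rcases Finset.mem_insert.1 hK with rfl | hK
      · exact Finset.mem_insert_of_mem (hs.mem _ a he.mem).2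
      · obtain ⟨w, hw, rfl⟩ := Finset.mem_image.1 hK
        exact Finset.mem_insert_of_mem (hs.home_fst_mem (hEP (Finset.mem_of_mem_erase hw)))
  · intro K X hX hsp
    by_cases hK : K ∈ D
    · exact (hI' K hK).1.spot X hX hsp
    · rwa [hI'2 K hK]
  · intro K r b hne hb
    by_cases hK : K ∈ D
    · refine (hI' K hK).1.ends r b ?_ hb
      split_ifs with hKJ
      · subst hKJ
        intro hsr
        exact hne (by rw [Option.some.inj hsr])
      · simp
    · rwa [hI'2 K hK]
  · simpa [hSJ] using (hI' J hJD).1.new_spot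

end TrackSystem

/-! ### Stacking a vertex onto a clique -/

section Stacking

open Layout

variable {W : Type*} [DecidableEq W]

/-- Two vertices `a`, `b` of the clique `C` have a spot of their own in the home of `a`, and
coinciding homes in `C` occur only between `a` and `b`. A vertex adjacent to all of `C` can then
share one occurrence between `a` and `b`. -/
def PairReady (I : W × W → Layout W) (h : W → W × W) (C : Finset W) : Prop :=
  ∃ a ∈ C, ∃ b ∈ C, a ≠ b ∧ Set.InjOn h (C.erase a) ∧ Set.InjOn h (C.erase b) ∧
    (I (h a)).Spot {a, b}

/-- The homes of the vertices of `C` are distinct, and on the side `s` of the layout `J` some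
`a ∈ C` is outermost, where `J` is not the home of another vertex of `C`. A vertex adjacent to all
of `C` can then be given its home beyond `a`. -/
def EndReady (I : W × W → Layout W) (h : W → W × W) (C : Finset W) (J : W × W) (s : Bool) :
    Prop :=
  Set.InjOn h C ∧ ∃ a ∈ C, (I J).End s a ∧ ∀ w ∈ C, w ≠ a → h w ≠ J

/-- A track system on `P` together with a family `𝓛` of `k`-subsets of `P` onto which further
vertices may be stacked. Each of them either has a spot of a pair or owns an end of a layout
exclusively. The Boolean labels allow the same `k`-subset to occur twice. -/
structure StackSystem (G : SimpleGraph W) (k : ℕ) (P : Finset W) (I : W × W → Layout W)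
    (h : W → W × W) (owner : (W × W) × Bool → Finset W × Bool) (𝓛 : Set (Finset W × Bool)) :
    Prop extends TrackSystem G k P I h where
  sub : ∀ c ∈ 𝓛, c.1 ⊆ P
  card_eq : ∀ c ∈ 𝓛, c.1.card = k
  ready : ∀ c ∈ 𝓛, PairReady I h c.1 ∨ ∃ J s, owner (J, s) = c ∧ EndReady I h c.1 J s

/-- The family obtained from `𝓛` by stacking `u` onto `c`: the label `c` is replaced by
the `k`-subsets of `insert u c` that contain `u`. -/
def stackFamily (𝓛 : Set (Finset W × Bool)) (c : Finset W × Bool) (u : W) :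
    Set (Finset W × Bool) :=
  {d | (d ∈ 𝓛 ∧ d ≠ c) ∨ ∃ w ∈ c.1, d = (insert u (c.1.erase w), false)}

variable {G : SimpleGraph W} {k : ℕ} {P : Finset W} {I I' : W × W → Layout W}
  {h : W → W × W} {u : W} {J₀ : W × W} {C : Finset W}

theorem injOn_update_iff (hu : u ∉ C) :
    Set.InjOn (Function.update h u J₀) C ↔ Set.InjOn h C := by
  refine Set.EqOn.injOn_iff fun x hx => ?_
  rw [Function.update_of_ne]
  rintro rfl
  exact hu hx

theorem injOn_update_insert (hu : u ∉ C) (hinj : Set.InjOn h C) (hJ₀ : ∀ w ∈ C, h w ≠ J₀) :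
    Set.InjOn (Function.update h u J₀) (insert u C : Finset W) := by
  rw [Finset.coe_insert, Set.injOn_insert (by exact_mod_cast hu), injOn_update_iff hu]
  refine ⟨hinj, ?_⟩
  rintro ⟨w, hw, hwu⟩
  rw [Function.update_self, Function.update_of_ne (by rintro rfl; exact hu hw)] at hwu
  exact hJ₀ w hw hwu

theorem PairReady.mono (hp : PairReady I h C) (hu : u ∉ C)
    (hsp : ∀ J X, X.Nonempty → (I J).Spot X → (I' J).Spot X) :
    PairReady I' (Function.update h u J₀) C := by
  obtain ⟨a, ha, b, hb, hab, h1, h2, h3⟩ := hp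
  refine ⟨a, ha, b, hb, hab, ?_, ?_, ?_⟩
  · rwa [injOn_update_iff fun h => hu (Finset.mem_of_mem_erase h)]
  · rwa [injOn_update_iff fun h => hu (Finset.mem_of_mem_erase h)]
  · rw [Function.update_of_ne (by rintro rfl; exact hu ha)]
    exact hsp _ _ (Set.insert_nonempty _ _) h3

theorem EndReady.mono {J : W × W} {s : Bool} (hp : EndReady I h C J s) (hu : u ∉ C)
    (he : ∀ a, (I J).End s a → (I' J).End s a) :
    EndReady I' (Function.update h u J₀) C J s := by
  obtain ⟨h1, a, ha, h2, h3⟩ := hp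
  refine ⟨(injOn_update_iff hu).2 h1, a, ha, he a h2, fun w hw hwa => ?_⟩
  rw [Function.update_of_ne (by rintro rfl; exact hu hw)]
  exact h3 w hw hwa

theorem endReady_insert (hu : u ∉ C) (hinj : Set.InjOn h C) (hJ₀ : ∀ w ∈ C, h w ≠ J₀)
    {J : W × W} {s : Bool} (hJ : ∀ w ∈ C, h w ≠ J) (he : (I' J).End s u) :
    EndReady I' (Function.update h u J₀) (insert u C) J s := by
  refine ⟨injOn_update_insert hu hinj hJ₀, u, Finset.mem_insert_self _ _, he, ?_⟩
  intro w hw hwu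
  rw [Function.update_of_ne hwu]
  exact hJ w (Finset.mem_of_mem_insert_of_ne hw hwu)

theorem pairReady_insert (hu : u ∉ C) (hinj : Set.InjOn h C) (hJ₀ : ∀ w ∈ C, h w ≠ J₀)
    {w : W} (hw : w ∈ C) (hsp : (I' (h w)).Spot {w, u}) :
    PairReady I' (Function.update h u J₀) (insert u C) := by
  have hwu : w ≠ u := by
    rintro rfl
    exact hu hw
  have hinj' := injOn_update_insert hu hinj hJ₀
  refine ⟨w, Finset.mem_insert_of_mem hw, u, Finset.mem_insert_self _ _, hwu,
    hinj'.mono ?_, hinj'.mono ?_, ?_⟩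
  · exact Finset.coe_subset.2 (Finset.erase_subset _ _)
  · exact Finset.coe_subset.2 (Finset.erase_subset _ _)
  · rwa [Function.update_of_ne hwu]

variable {owner : (W × W) × Bool → Finset W × Bool} {𝓛 : Set (Finset W × Bool)}
  {c : Finset W × Bool}

/-- To extend a stack system by `u`, it suffices to extend the track system such that ends not
owned by `c` survive, and to assign ends to the new cliques that are not ready by a pair. -/
theorem StackSystem.stack (hs : StackSystem G k P I h owner 𝓛) (hu : u ∉ P) (hc : c ∈ 𝓛)
    (ht : TrackSystem G k (insert u P) I' (Function.update h u J₀))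
    (hsp : ∀ J X, X.Nonempty → (I J).Spot X → (I' J).Spot X)
    (he : ∀ J s a, owner (J, s) ≠ c → (I J).End s a → (I' J).End s a)
    (new : (W × W) × Bool → Finset W × Bool)
    (hnew : ∀ J s, new (J, s) ≠ owner (J, s) → J.1 ∉ P ∨ owner (J, s) = c)
    (hready : ∀ w ∈ c.1, PairReady I' (Function.update h u J₀) (insert u (c.1.erase w)) ∨
      ∃ J s, new (J, s) = (insert u (c.1.erase w), false) ∧
        EndReady I' (Function.update h u J₀) (insert u (c.1.erase w)) J s) :
    StackSystem G k (insert u P) I' (Function.update h u J₀) new (stackFamily 𝓛 c u) := by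
  refine ⟨ht, ?_, ?_, ?_⟩
  · rintro d (⟨hd, -⟩ | ⟨w, hw, rfl⟩)
    · exact (hs.sub d hd).trans (Finset.subset_insert _ _)
    · exact Finset.insert_subset_insert _ ((Finset.erase_subset _ _).trans (hs.sub c hc))
  · rintro d (⟨hd, -⟩ | ⟨w, hw, rfl⟩)
    · exact hs.card_eq d hd
    · have huc : u ∉ c.1.erase w := fun h' => hu (hs.sub c hc (Finset.mem_of_mem_erase h'))
      rw [Finset.card_insert_of_notMem huc, Finset.card_erase_add_one hw, hs.card_eq c hc]
  · rintro d (⟨hd, hdc⟩ | ⟨w, hw, rfl⟩)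
    · have hud : u ∉ d.1 := fun h' => hu (hs.sub d hd h')
      rcases hs.ready d hd with hp | ⟨J, s, hJ, hE⟩
      · exact Or.inl (hp.mono hud hsp)
      · have hJc : owner (J, s) ≠ c := by rwa [hJ]
        refine Or.inr ⟨J, s, ?_, hE.mono hud fun a => he J s a hJc⟩
        by_contra hne
        rcases hnew J s (by rwa [hJ]) with h' | h'
        · obtain ⟨-, a, -, ha, -⟩ := hE
          exact h' (hs.mem J a ha.mem).2
        · exact hJc h'
    · exact hready w hw

/-- If `u` is added to a clique with a ready pair without destroying any spot or end, and gets a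
new home, then the pair still serves the new cliques containing it, and the remaining two own the
two ends of the home of `u`. -/
theorem StackSystem.stack_pair_aux (hs : StackSystem G k P I h owner 𝓛) (hu : u ∉ P)
    (hc : c ∈ 𝓛) {a b : W} (ha : a ∈ c.1) (hb : b ∈ c.1) (hab : a ≠ b)
    (hia : Set.InjOn h (c.1.erase a)) (hib : Set.InjOn h (c.1.erase b))
    (hspot : (I (h a)).Spot {a, b})
    (ht : TrackSystem G k (insert u P) I' (Function.update h u (u, u)))
    (hsp : ∀ J X, X.Nonempty → (I J).Spot X → (I' J).Spot X)
    (he : ∀ J s a, (I J).End s a → (I' J).End s a) (heu : ∀ s, (I' (u, u)).End s u) :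
    ∃ I' h' owner', StackSystem G k (insert u P) I' h' owner' (stackFamily 𝓛 c u) := by
  have huC : u ∉ c.1 := fun h' => hu (hs.sub c hc h')
  have huE : ∀ w, u ∉ c.1.erase w := fun w h' => huC (Finset.mem_of_mem_erase h')
  have hhu : ∀ w ∈ c.1, h w ≠ (u, u) := by
    intro w hw hwx
    have := hs.home_fst_mem (hs.sub c hc hw)
    rw [hwx] at this
    exact hu this
  have hhuE : ∀ x, ∀ w ∈ c.1.erase x, h w ≠ (u, u) :=
    fun x w hw => hhu w (Finset.mem_of_mem_erase hw)
  refine ⟨_, _, fun x => if x.1.1 = u then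
    (insert u (c.1.erase (if x.2 then a else b)), false) else owner x,
    hs.stack hu hc ht hsp (fun J s x _ => he J s x) _ ?_ ?_⟩
  · intro J s hne
    left
    by_contra hJ
    refine hne (if_neg ?_)
    rintro rfl
    exact hu hJ
  intro w hw
  by_cases hwa : w = a
  · subst hwa
    exact Or.inr ⟨(u, u), true, by simp,
      endReady_insert (huE _) hia (hhuE _) (hhuE _) (heu true)⟩
  by_cases hwb : w = b
  · subst hwb
    exact Or.inr ⟨(u, u), false, by simp,
      endReady_insert (huE _) hib (hhuE _) (hhuE _) (heu false)⟩
  left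
  have hau : a ≠ u := by
    rintro rfl
    exact huC ha
  have hbu : b ≠ u := by
    rintro rfl
    exact huC hb
  have key : ∀ x, x ≠ u → Set.InjOn h (c.1.erase x) →
      Set.InjOn (Function.update h u (u, u)) ((insert u (c.1.erase w)).erase x : Finset W) := by
    intro x hxu hx
    refine (injOn_update_insert (huE x) hx (hhuE x)).mono (Finset.coe_subset.2 ?_)
    rw [Finset.erase_insert_of_ne hxu.symm]
    exact Finset.insert_subset_insert _
      (Finset.erase_subset_erase _ (Finset.erase_subset _ _))
  refine ⟨a, ?_, b, ?_, hab, key a hau hia, key b hbu hib, ?_⟩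
  · exact Finset.mem_insert_of_mem (Finset.mem_erase.2 ⟨Ne.symm hwa, ha⟩)
  · exact Finset.mem_insert_of_mem (Finset.mem_erase.2 ⟨Ne.symm hwb, hb⟩)
  · rw [Function.update_of_ne hau]
    exact hsp _ _ (Set.insert_nonempty _ _) hspot

/-- Stacking onto a clique with a ready pair. If `u` is adjacent to both vertices of the pair, one
occurrence is saved by sharing their spot; otherwise `u` has fewer than `k` neighbours. Either way
an occurrence is left for a new home. -/
theorem StackSystem.exists_stack_pair (hs : StackSystem G k P I h owner 𝓛) (hu : u ∉ P)
    (hc : c ∈ 𝓛) {E : Finset W} (hEc : E ⊆ c.1) (hE : ∀ w ∈ P, G.Adj u w ↔ w ∈ E)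
    (hp : PairReady I h c.1) :
    ∃ I' h' owner', StackSystem G k (insert u P) I' h' owner' (stackFamily 𝓛 c u) := by
  obtain ⟨a, ha, b, hb, hab, hia, hib, hspot⟩ := hp
  have hEP := hEc.trans (hs.sub c hc)
  have hck := hs.card_eq c hc
  by_cases hE2 : a ∈ E ∧ b ∈ E
  · have hEk : E.card ≤ k := hck ▸ Finset.card_le_card hEc
    obtain ⟨I', ht, hsp, he, heu⟩ := hs.exists_add_pair hu hEP hE hEk hE2.1 hE2.2 hab
      (hib.mono (Finset.coe_subset.2 (Finset.erase_subset_erase _ hEc))) hspot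
    exact hs.stack_pair_aux hu hc ha hb hab hia hib hspot ht hsp he heu
  · have hinjlt : Set.InjOn h E ∧ E.card < k := by
      by_cases haE : a ∈ E
      · have hsub : E ⊆ c.1.erase b :=
          Finset.subset_erase.2 ⟨hEc, fun hbE => hE2 ⟨haE, hbE⟩⟩
        refine ⟨hib.mono (Finset.coe_subset.2 hsub), ?_⟩
        have := Finset.card_le_card hsub
        have := Finset.card_erase_add_one hb
        omega
      · have hsub : E ⊆ c.1.erase a := Finset.subset_erase.2 ⟨hEc, haE⟩
        refine ⟨hia.mono (Finset.coe_subset.2 hsub), ?_⟩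
        have := Finset.card_le_card hsub
        have := Finset.card_erase_add_one ha
        omega
    obtain ⟨I', ht, hsp, he, -, heu⟩ := hs.exists_add_leaf hu hEP hE hinjlt.1
      (Finset.mem_singleton_self u) (by simpa using hinjlt.2)
    exact hs.stack_pair_aux hu hc ha hb hab hia hib hspot ht hsp he
      (heu u (Finset.mem_singleton_self u))

/-- Stacking onto a clique owning an end at the vertex `a`. If `u` is adjacent to `a`, its home is
the continuation beyond `a`; otherwise `u` has fewer than `k` neighbours, and new layouts are
available. -/
theorem StackSystem.exists_stack_end [Finite W] (hs : StackSystem G k P I h owner 𝓛)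
    (hu : u ∉ P) (hc : c ∈ 𝓛) {E : Finset W} (hEc : E ⊆ c.1)
    (hE : ∀ w ∈ P, G.Adj u w ↔ w ∈ E) {J : W × W} {s : Bool} (ho : owner (J, s) = c)
    (hp : EndReady I h c.1 J s) :
    ∃ I' h' owner', StackSystem G k (insert u P) I' h' owner' (stackFamily 𝓛 c u) := by
  obtain ⟨hinj, a, ha, hend, hJ⟩ := hp
  have hEP := hEc.trans (hs.sub c hc)
  have hck := hs.card_eq c hc
  have huC : u ∉ c.1 := fun h' => hu (hs.sub c hc h')
  have huE : ∀ w, u ∉ c.1.erase w := fun w h' => huC (Finset.mem_of_mem_erase h')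
  have hsubE : ∀ w, (c.1.erase w : Set W) ⊆ c.1 := fun w => by simp
  have hau : a ≠ u := by
    rintro rfl
    exact huC ha
  by_cases haE : a ∈ E
  · have hEk : E.card ≤ k := hck ▸ Finset.card_le_card hEc
    obtain ⟨I', ht, hsp, he, hspu, heu⟩ := hs.exists_add_end hu hEP hE hEk haE
      (hinj.mono (Finset.coe_subset.2 hEc)) hend fun w hw => hJ w (hEc hw)
    have hJa : ∀ w ∈ c.1.erase a, h w ≠ J := fun w hw =>
      hJ w (Finset.mem_of_mem_erase hw) (Finset.ne_of_mem_erase hw)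
    refine ⟨_, _, Function.update owner (J, s) (insert u (c.1.erase a), false),
      hs.stack hu hc ht hsp (fun K r x hK => he K r x ?_) _ ?_ ?_⟩
    · rintro h'
      exact hK (h' ▸ ho)
    · intro K r hne
      right
      by_contra hK
      refine hne (Function.update_of_ne ?_ ..)
      rintro h'
      exact hK (h' ▸ ho)
    · intro w hw
      by_cases hwa : w = a
      · subst hwa
        exact Or.inr ⟨J, s, Function.update_self .., endReady_insert (huE _)
          (hinj.mono (hsubE _)) hJa hJa heu⟩
      -- The overlap of `u` and `a` in the layout `J` serves the cliques containing both.
      · left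
        refine ⟨u, Finset.mem_insert_self _ _, a, ?_, hau.symm, ?_, ?_, ?_⟩
        · exact Finset.mem_insert_of_mem (Finset.mem_erase.2 ⟨Ne.symm hwa, ha⟩)
        · rw [Finset.erase_insert (huE w), injOn_update_iff (huE w)]
          exact hinj.mono (hsubE _)
        · refine (injOn_update_insert (huE a) (hinj.mono (hsubE _)) hJa).mono
            (Finset.coe_subset.2 ?_)
          rw [Finset.erase_insert_of_ne hau.symm]
          exact Finset.insert_subset_insert _
            (Finset.erase_subset_erase _ (Finset.erase_subset _ _))
        · rwa [Function.update_self]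
  · have hElt : E.card < k := by
      have := Finset.card_le_card (Finset.subset_erase.2 ⟨hEc, haE⟩)
      have := Finset.card_erase_add_one ha
      omega
    -- A new clique contains a neighbour of `u`, or it avoids `E`. In the latter case it omits the
    -- only element of `E`, or `E` is empty; so `|F|` new layouts suffice.
    obtain ⟨F, w₀, hw₀, hF, hFcard⟩ : ∃ F : Finset W, ∃ w₀ ∈ F,
        (∀ w ∈ c.1, (∃ x ∈ E, x ≠ w) ∨ w ∈ F) ∧ E.card + F.card ≤ k := by
      rcases E.eq_empty_or_nonempty with rfl | ⟨x, hx⟩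
      · exact ⟨c.1, a, ha, fun w hw => Or.inr hw, by simp [hck]⟩
      · refine ⟨{x}, x, Finset.mem_singleton_self x, fun w hw => ?_, by simpa using hElt⟩
        by_cases hxw : x = w
        · exact Or.inr (by simp [hxw])
        · exact Or.inl ⟨x, hx, hxw⟩
    obtain ⟨I', ht, hsp, he, hspE, heu⟩ := hs.exists_add_leaf hu hEP hE
      (hinj.mono (Finset.coe_subset.2 hEc)) hw₀ hFcard
    have hhu : ∀ y, ∀ w ∈ c.1, h w ≠ (u, y) := by
      intro y w hw hwx
      have := hs.home_fst_mem (hs.sub c hc hw)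
      rw [hwx] at this
      exact hu this
    have hhuE : ∀ y x, ∀ w ∈ c.1.erase x, h w ≠ (u, y) :=
      fun y x w hw => hhu y w (Finset.mem_of_mem_erase hw)
    refine ⟨_, _, fun x => if x.1.1 = u then (insert u (c.1.erase x.1.2), false) else owner x,
      hs.stack hu hc ht hsp (fun J s x _ => he J s x) _ ?_ ?_⟩
    · intro J s hne
      left
      by_contra hJ
      refine hne (if_neg ?_)
      rintro rfl
      exact hu hJ
    · intro w hw
      rcases hF w hw with ⟨x, hx, hxw⟩ | hwF
      · exact Or.inl (pairReady_insert (huE w) (hinj.mono (hsubE _)) (hhuE _ _)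
          (Finset.mem_erase.2 ⟨hxw, hEc hx⟩) (hspE x hx))
      · exact Or.inr ⟨(u, w), true, by simp, endReady_insert (huE w)
          (hinj.mono (hsubE _)) (hhuE _ _) (hhuE _ _) (heu w hwF true)⟩

/-- A vertex can be stacked onto any member of the family. -/
theorem StackSystem.exists_stack [Finite W] (hs : StackSystem G k P I h owner 𝓛)
    (hu : u ∉ P) (hc : c ∈ 𝓛) {E : Finset W} (hEc : E ⊆ c.1)
    (hE : ∀ w ∈ P, G.Adj u w ↔ w ∈ E) :
    ∃ I' h' owner', StackSystem G k (insert u P) I' h' owner' (stackFamily 𝓛 c u) := by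
  rcases hs.ready c hc with hp | ⟨J, s, ho, hp⟩
  · exact hs.exists_stack_pair hu hc hEc hE hp
  · exact hs.exists_stack_end hu hc hEc hE ho hp

theorem StackSystem.mono {𝓛' : Set (Finset W × Bool)} (hs : StackSystem G k P I h owner 𝓛)
    (h𝓛 : 𝓛' ⊆ 𝓛) : StackSystem G k P I h owner 𝓛' :=
  ⟨hs.toTrackSystem, fun c hc => hs.sub c (h𝓛 hc), fun c hc => hs.card_eq c (h𝓛 hc),
    fun c hc => hs.ready c (h𝓛 hc)⟩

/-- At most `k` vertices can be given distinct homes, since each has fewer than `k` predecessors.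
The first of them is outermost on both sides of its home. -/
theorem exists_trackSystem_injOn (G : SimpleGraph W) (k : ℕ) (P : Finset W) (hP : P.Nonempty)
    (hPk : P.card ≤ k) :
    ∃ I h, TrackSystem G k P I h ∧ Set.InjOn h P ∧ ∃ a ∈ P, ∀ s, (I (h a)).End s a := by
  classical
  have hE : ∀ (Q : Finset W) (v : W), ∀ w ∈ Q, G.Adj v w ↔ w ∈ Q.filter (G.Adj v) :=
    fun Q v w hw => by simp [hw]
  induction hP using Finset.Nonempty.cons_induction with
  | singleton v =>
    have h0 : TrackSystem G k ∅ (fun _ _ => (1, 0)) (fun w => (w, w)) := by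
      have hno : ∀ w, ¬ Mem (fun _ : W => ((1 : ℝ), (0 : ℝ))) w := by
        intro w
        simp only [Mem]
        norm_num
      exact ⟨fun J a b _ hm => absurd hm.mem_left (hno a), by simp,
        fun J v hv => absurd hv (hno v), by simp [hno], by simp⟩
    obtain ⟨I', ht, -, -, -, he⟩ := h0.exists_add_leaf (Finset.notMem_empty v)
      (Finset.filter_subset (G.Adj v) ∅) (hE ∅ v) (by simp) (Finset.mem_singleton_self v)
      (by simpa using hPk)
    refine ⟨I', _, ht, by simp, v, Finset.mem_singleton_self v, fun s => ?_⟩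
    rw [Function.update_self]
    exact he v (Finset.mem_singleton_self v) s
  | cons u Q hu hQ ih =>
    rw [Finset.card_cons] at hPk
    obtain ⟨I, h, ht, hinj, a, ha, hend⟩ := ih (by omega)
    have hcard : (Q.filter (G.Adj u)).card ≤ Q.card :=
      Finset.card_le_card (Finset.filter_subset _ _)
    obtain ⟨I', ht', -, he, -⟩ := ht.exists_add_leaf hu (Finset.filter_subset (G.Adj u) Q)
      (hE Q u) (hinj.mono (Finset.coe_subset.2 (Finset.filter_subset _ _)))
      (Finset.mem_singleton_self u) (by rw [Finset.card_singleton]; omega)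
    rw [Finset.cons_eq_insert]
    refine ⟨I', _, ht', injOn_update_insert hu hinj ?_, a, Finset.mem_insert_of_mem ha, ?_⟩
    · intro w hw hwu
      have := ht.home_fst_mem hw
      rw [hwu] at this
      exact hu this
    · intro s
      rw [Function.update_of_ne (by rintro rfl; exact hu ha)]
      exact he _ s a (hend s)

/-- Any `k ≥ 1` vertices have a stack system in which their set can be stacked onto twice, since
it owns both ends of one layout. -/
theorem exists_stackSystem_twice (G : SimpleGraph W) {k : ℕ} {P : Finset W} (hP : P.Nonempty)
    (hPk : P.card = k) :
    ∃ I h owner, StackSystem G k P I h owner {(P, true), (P, false)} := by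
  obtain ⟨I, h, ht, hinj, a, ha, he⟩ := exists_trackSystem_injOn G k P hP hPk.le
  refine ⟨I, h, fun x => (P, x.2), ht, ?_, ?_, ?_⟩
  · rintro c (rfl | rfl) <;> exact subset_rfl
  · rintro c (rfl | rfl) <;> exact hPk
  · have key : ∀ s, EndReady I h P (h a) s := fun s =>
      ⟨hinj, a, ha, he s, fun w hw hwa h' => hwa (hinj hw ha h')⟩
    rintro c (rfl | rfl)
    · exact Or.inr ⟨h a, true, rfl, key true⟩
    · exact Or.inr ⟨h a, false, rfl, key false⟩

end Stacking

/-! ### Track systems from construction sequences -/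

section Construction

open Layout

theorem Finset.exists_eq_insert_erase {α : Type*} [DecidableEq α] {C D : Finset α} {u : α}
    (huD : u ∈ D) (hcard : D.card = C.card) (hD : D.erase u ⊆ C) :
    ∃ w ∈ C, D = insert u (C.erase w) := by
  have h1 := Finset.card_erase_add_one huD
  obtain ⟨w, hw, hwD⟩ := Finset.exists_mem_notMem_of_card_lt_card
    (show (D.erase u).card < C.card by omega)
  refine ⟨w, hw, ?_⟩
  have h2 := Finset.card_erase_add_one hw
  rw [← Finset.eq_of_subset_of_card_le (Finset.subset_erase.2 ⟨hD, hwD⟩) (by omega),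
    Finset.insert_erase huD]

/-- Following a construction sequence of a simple `k`-tree, the family of `k`-cliques not yet
used for stacking is maintained in a stack system of any subgraph `G`. -/
theorem exists_trackSystem_of_isConstructionSequence {W : Type*} [Fintype W] [DecidableEq W]
    {G T : SimpleGraph W} (hGT : G ≤ T) {k : ℕ} (hk : 1 ≤ k) {n : ℕ} {v : Fin n ≃ W}
    (hv : IsConstructionSequence k T v)
    (hsimple : ∀ i j : Fin n, k < (i : ℕ) → k < (j : ℕ) →
      earlierNeighbors T v i = earlierNeighbors T v j → i = j) :
    ∃ I h, TrackSystem G k Finset.univ I h := by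
  classical
  set P : ℕ → Finset W := fun m => Finset.univ.filter fun w => (v.symm w : ℕ) < m with hPdef
  have hmemP : ∀ m w, w ∈ P m ↔ (v.symm w : ℕ) < m := by simp [hPdef]
  have hPsucc : ∀ m (hm : m < n), P (m + 1) = insert (v ⟨m, hm⟩) (P m) := by
    intro m hm
    ext w
    rw [Finset.mem_insert, hmemP, hmemP, ← Equiv.symm_apply_eq, Fin.ext_iff]
    simp only
    omega
  have hnotMem : ∀ m (hm : m < n), v ⟨m, hm⟩ ∉ P m := by simp [hmemP]
  have hPcard : ∀ m ≤ n, (P m).card = m := by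
    intro m
    induction m with
    | zero => simp [hPdef]
    | succ m ih =>
      intro hm
      rw [hPsucc m hm, Finset.card_insert_of_notMem (hnotMem m hm), ih (by omega)]
  set live : ℕ → Set (Finset W × Bool) := fun m =>
    {c | c.2 = false ∧ c.1 ⊆ P m ∧ T.IsClique c.1 ∧ c.1.card = k ∧
      ∀ i : Fin n, k < (i : ℕ) → (i : ℕ) < m → earlierNeighbors T v i ≠ c.1} with hlive
  have hkn := hv.card_le
  have key : ∀ m, k + 1 ≤ m → m ≤ n → ∃ I h owner, StackSystem G k (P m) I h owner (live m) := by
    intro m hkm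
    induction m, hkm using Nat.le_induction with
    | base =>
      intro _
      have hPk : (P k).card = k := hPcard k (by omega)
      obtain ⟨I, h, owner, hs⟩ := exists_stackSystem_twice G
        (Finset.card_pos.1 (by omega) : (P k).Nonempty) hPk
      -- The vertex with index `k` uses one of the two copies of the initial `k`-set; the other
      -- remains, since a later vertex may be stacked onto that set as well.
      obtain ⟨I', h', owner', hs'⟩ := hs.exists_stack (hnotMem k hkn)
        (c := (P k, true)) (Or.inl rfl) (Finset.filter_subset (G.Adj (v ⟨k, hkn⟩)) (P k))
        (by simp +contextual)
      rw [hPsucc k hkn]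
      refine ⟨I', h', owner', hs'.mono ?_⟩
      rintro ⟨c, t⟩ ⟨rfl, hcP, -, hck, -⟩
      rw [hPsucc k hkn] at hcP
      simp only at hcP hck
      by_cases hu : v ⟨k, hkn⟩ ∈ c
      · obtain ⟨w, hw, hcw⟩ := Finset.exists_eq_insert_erase hu (hck.trans hPk.symm)
          (fun x hx => Finset.mem_of_mem_insert_of_ne (hcP (Finset.mem_of_mem_erase hx))
              (Finset.ne_of_mem_erase hx))
        exact Or.inr ⟨w, hw, by rw [hcw]⟩
      · have : c = P k := Finset.eq_of_subset_of_card_le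
          ((Finset.subset_insert_iff_of_notMem hu).1 hcP) (by omega)
        subst this
        exact Or.inl ⟨Or.inr rfl, by simp⟩
    | succ m hkm ih =>
      intro hmn
      have hm : m < n := hmn
      obtain ⟨I, h, owner, hs⟩ := ih (by omega)
      set u := v ⟨m, hm⟩ with hudef
      set C : Finset W := (earlierNeighbors T v ⟨m, hm⟩).toFinset with hCdef
      have hCcoe : (C : Set W) = earlierNeighbors T v ⟨m, hm⟩ := Set.coe_toFinset _
      have hmemC : ∀ w, w ∈ C ↔ T.Adj u w ∧ w ∈ P m := by
        intro w
        rw [hCdef, Set.mem_toFinset, hmemP]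
        rfl
      have hCk : C.card = k := by
        have := hv.stack_card ⟨m, hm⟩ hkm
        rw [← hCcoe, Set.encard_coe_eq_coe_finsetCard] at this
        exact_mod_cast this
      have hCP : C ⊆ P m := fun w hw => ((hmemC w).1 hw).2
      have hClive : (C, false) ∈ live m := by
        refine ⟨rfl, hCP, ?_, hCk, fun i hi him hiC => ?_⟩
        · simpa only [hCcoe] using hv.stack_clique ⟨m, hm⟩ hkm
        · simp only [hCcoe] at hiC
          have := hsimple i ⟨m, hm⟩ hi hkm hiC
          rw [this] at him
          exact lt_irrefl _ him
      obtain ⟨I', h', owner', hs'⟩ := hs.exists_stack (hnotMem m hm) hClive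
        (E := (P m).filter (G.Adj u))
        (fun w hw => (hmemC w).2 ⟨hGT (Finset.mem_filter.1 hw).2, (Finset.mem_filter.1 hw).1⟩)
        (by simp +contextual [hudef])
      rw [hPsucc m hm]
      refine ⟨I', h', owner', hs'.mono ?_⟩
      rintro ⟨c, t⟩ ⟨rfl, hcP, hcT, hck, hci⟩
      rw [hPsucc m hm] at hcP
      simp only at hcP hcT hck hci
      by_cases hu : u ∈ c
      · obtain ⟨w, hw, hcw⟩ := Finset.exists_eq_insert_erase hu
          (hck.trans hCk.symm) (by
            intro x hx
            obtain ⟨hxu, hxc⟩ := Finset.mem_erase.1 hx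
            exact (hmemC x).2 ⟨hcT hu hxc hxu.symm,
              Finset.mem_of_mem_insert_of_ne (hcP hxc) hxu⟩)
        exact Or.inr ⟨w, hw, by rw [hcw]⟩
      · refine Or.inl ⟨⟨rfl, (Finset.subset_insert_iff_of_notMem hu).1 hcP, hcT, hck,
          fun i hi him => hci i hi (by omega)⟩, fun hcC => ?_⟩
        have hcC' : c = C := congrArg Prod.fst hcC
        exact hci ⟨m, hm⟩ hkm (Nat.lt_succ_self m) (by rw [hcC', hCcoe])
  obtain ⟨I, h, owner, hs⟩ := key n hkn le_rfl
  have hPn : P n = Finset.univ := by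
    ext w
    simp [hmemP]
  exact ⟨I, h, hPn ▸ hs.toTrackSystem⟩

theorem adj_false_of_isConstructionSequence_zero {W : Type*} {T : SimpleGraph W} {n : ℕ}
    {v : Fin n ≃ W} (hv : IsConstructionSequence 0 T v) (a b : W) : ¬ T.Adj a b := by
  have key : ∀ i j : Fin n, j < i → ¬ T.Adj (v i) (v j) := by
    intro i j hji hadj
    have h0 := hv.stack_card i (by have : (j : ℕ) < i := hji; omega)
    rw [Nat.cast_zero, Set.encard_eq_zero] at h0
    have : v j ∈ earlierNeighbors T v i := ⟨hadj, by simpa using hji⟩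
    simp [h0] at this
  intro hab
  rcases lt_trichotomy (v.symm a) (v.symm b) with h | h | h
  · exact key _ _ h (by simpa using hab.symm)
  · exact hab.ne (v.symm.injective h)
  · exact key _ _ h (by simpa using hab)

end Construction

/-! ### Covers from track systems -/

section TrackCover

open Layout

theorem localTrackNumber_eq_zero {V : Type u} {G : SimpleGraph V} (hG : ∀ a b, ¬ G.Adj a b) :
    localTrackNumber G = 0 := by
  let φ : Cover IsIntervalGraph G :=
    { size := 0
      vertexType := fun i => i.elim0
      finite_vertexType := fun i => i.elim0
      template := fun i => i.elim0
      template_mem := fun i => i.elim0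
      hom := ⟨fun x => x.1.elim0, fun {x} => x.1.elim0⟩
      edge_surjective := fun a b hab => absurd hab (hG a b) }
  refine nonpos_iff_eq_zero.1 ((iInf₂_le φ fun i => i.elim0).trans (iSup_le fun v => ?_))
  rw [nonpos_iff_eq_zero, Set.encard_eq_zero]
  exact Set.eq_empty_of_forall_notMem fun x => x.1.elim0

/-- The nonempty intervals of a layout, seen through `f : V → W`, as an interval graph. -/
def Layout.graph {V W : Type*} (I : Layout W) (f : V → W) :
    SimpleGraph {x : V // I.Mem (f x)} where
  Adj x y := x ≠ y ∧ I.Meets (f x) (f y)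
  symm := ⟨fun _ _ h => ⟨h.1.symm, h.2.symm⟩⟩
  loopless := ⟨fun _ h => h.1 rfl⟩

theorem Layout.isIntervalGraph_graph {V : Type u} {W : Type*} (I : Layout W) (f : V → W) :
    IsIntervalGraph (I.graph f) :=
  ⟨fun x => (I (f x)).1, fun x => (I (f x)).2, fun x => x.2,
    fun _ _ hab => ⟨fun h => h.2, fun h => ⟨hab, h⟩⟩⟩

theorem TrackSystem.localTrackNumber_le {V : Type u} [Finite V] {W : Type*} [Fintype W]
    {G : SimpleGraph V} (f : V ↪ W) {k : ℕ} {I : W × W → Layout W} {h : W → W × W}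
    (hs : TrackSystem (G.map f) k Finset.univ I h) : localTrackNumber G ≤ k := by
  classical
  have hadj : ∀ a b, (G.map f).Adj (f a) (f b) ↔ G.Adj a b := fun a b =>
    SimpleGraph.map_adj_apply
  let e := (Fintype.equivFin (W × W)).symm
  let φ : Cover IsIntervalGraph G :=
    { size := Fintype.card (W × W)
      vertexType := fun i => {x : V // (I (e i)).Mem (f x)}
      finite_vertexType := fun i => inferInstance
      template := fun i => (I (e i)).graph f
      template_mem := fun i => (I (e i)).isIntervalGraph_graph f
      hom := ⟨fun x => x.2.1, by
        rintro _ _ ⟨i, a, b, hab, rfl, rfl⟩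
        exact (hadj _ _).1 (hs.adj (e i) _ _ (fun h' => hab.1 (Subtype.ext (f.injective h')))
          hab.2)⟩
      edge_surjective := fun a b hab => by
        obtain ⟨J, hJ⟩ := hs.cover (f a) (Finset.mem_univ _) (f b) (Finset.mem_univ _)
          ((hadj a b).2 hab)
        obtain ⟨i, rfl⟩ := e.surjective J
        exact ⟨⟨i, a, hJ.mem_left⟩, ⟨i, b, hJ.mem_right⟩,
          ⟨i, _, _, ⟨fun h' => hab.ne (congrArg Subtype.val h'), hJ⟩, rfl, rfl⟩, rfl, rfl⟩ }
  have hφ : φ.IsInjective := fun i a b hab => Subtype.ext hab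
  refine (iInf₂_le φ hφ).trans (iSup_le fun v => ?_)
  refine le_trans ?_ (hs.card (f v))
  refine Set.encard_le_encard_of_injOn (f := fun x => e x.1) ?_ ?_
  · rintro ⟨i, x⟩ hx
    have hx' : x.1 = v := hx
    rw [← hx']
    exact x.2
  · rintro ⟨i, x⟩ hx ⟨j, y⟩ hy hxy
    obtain rfl : i = j := e.injective hxy
    have hx' : x.1 = v := hx
    have hy' : y.1 = v := hy
    rw [Subtype.ext (hx'.trans hy'.symm)]

end TrackCover

theorem mainTheorem2 {V : Type u} [Finite V] (G : SimpleGraph V) :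
    localTrackNumber G ≤ simpleTreeWidth G := by
  refine le_iInf₂ fun k hG => ?_
  obtain ⟨m, T, ⟨n, v, hv, hsimple⟩, ⟨f⟩⟩ := hG
  rcases Nat.eq_zero_or_pos k with rfl | hk
  · exact (localTrackNumber_eq_zero fun a b hab =>
      adj_false_of_isConstructionSequence_zero hv _ _ (f.toHom.map_adj hab)).trans_le zero_le
  · have hGT : G.map f.toEmbedding ≤ T := by
      rw [SimpleGraph.map_le_iff_le_comap]
      exact fun a b hab => f.toHom.map_adj hab
    obtain ⟨I, h, hs⟩ := exists_trackSystem_of_isConstructionSequence hGT hk hv hsimple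
    exact hs.localTrackNumber_le f.toEmbedding
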